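/- Let $\mathrm{Out}$ be the category of finite groups and conjugacy classes of surjective homomorphisms. A $\mathbb{Q}[\mathrm{Out}^{op}]$-module is a functor $\mathrm{Out}^{op}\to \mathbb{Q}\text{-Mod}$. For a finite group $G$ let $L(G)$ be the simplicial set whose $k$-simplices are the chains $H_0\le\dots\le H_k$ of subgroups of $G$ (the nerve of the subgroup lattice), and for $n\in\mathbb{N}\cup\{\infty\}$ let $L(G)_n\subseteq L(G)$ consist of the chains of total index $[H_k:H_0]\le n$. Let $\widetilde L(G)_n$ be the quotient of $L(G)_n$ by the subcomplex of chains with $H_k\ne G$; $G$ acts on it by conjugation. A surjection $\psi:G\to K$ sends $[H_0\le\dots\le H_k]$ to $[\psi^{-1}(H_0)\le\dots\le\psi^{-1}(H_k)]$, so that $G\mapsto \widetilde L(G)_n/G$ is a functor from $\mathrm{Out}^{op}$ to pointed simplicial sets. Let $\mathcal{C}\widetilde L_n$ be the chain complex of $\mathbb{Q}[\mathrm{Out}^{op}]$-modules of normalized rational chains (modulo the base point) on this functor, and write $\mathcal{C}\widetilde L=\mathcal{C}\widetilde L_\infty$. Call a chain $H_0\lneq\dots\lneq H_k$ of finite groups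 simple if $H_0$ contains no non-trivial normal subgroup of $H_k$. Let $\mathrm{Out}(H_0\lneq\dots\lneq H_k)$ be the group of conjugacy classes of automorphisms of $H_k$ which map the chain to an $H_k$-conjugate of itself; it acts on the representable module $\mathbb{Q}[\mathrm{Out}(-,H_k)]$ by postcomposition. Proposition. Let $n\in\mathbb{N}\cup\{\infty\}$ and $k\ge 0$. (1) $(\mathcal{C}\widetilde L_n)_k$ is a projective $\mathbb{Q}[\mathrm{Out}^{op}]$-module. (2) The maps sending the class of $\psi:G\twoheadrightarrow H_k$ to the class of the chain $\psi^{-1}(H_0)\lneq\dots\lneq\psi^{-1}(H_k)=G$ induce an isomorphism of $\mathbb{Q}[\mathrm{Out}^{op}]$-modules \[ \bigoplus_{[H_0\lneq\dots\lneq H_k]} \mathbb{Q}[\mathrm{Out}(-,H_k)]/\mathrm{Out}(H_0\lneq\dots\lneq H_k)\;\cong\;(\mathcal{C}\widetilde L_n)_k, \] where the sum runs over representatives of the isomorphism classes of simple chains $H_0\lneq\dots\lneq H_k$ with $[H_k:H_0]\le n$, and the quotient denotes the orbits (coinvariants) of the action. (3) $\mathcal{C}\widetilde L$ is a projective resolution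 of the $\mathbb{Q}[\mathrm{Out}^{op}]$-module that sends the trivial group to $\mathbb{Q}$ and all other finite groups to $0$. -/

import Mathlib

open CategoryTheory Opposite Limits Simplicial

noncomputable section

/-! ### The category `Out` and its rational modules -/

/-- The objects of the category `Out`: finite groups. -/
structure OutCat where
  of ::
  carrier : Type
  [group : Group carrier]
  [finite : Finite carrier]

namespace OutCat

instance : CoeSort OutCat Type := ⟨OutCat.carrier⟩

instance (G : OutCat) : Group G := G.group

instance (G : OutCat) : Finite G := G.finite

/-- Surjective group homomorphisms. -/
abbrev Epim (G K : OutCat) : Type := {f : G →* K // Function.Surjective f}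

/-- Two surjective homomorphisms are conjugate if they differ by an inner automorphism of the
target. -/
def conjSetoid (G K : OutCat) : Setoid (Epim G K) where
  r f g := ∃ k : K, ∀ x, g.1 x = k * f.1 x * k⁻¹
  iseqv :=
    { refl := fun f => ⟨1, by simp⟩
      symm := by
        rintro f g ⟨k, h⟩
        exact ⟨k⁻¹, fun x => by rw [h]; group⟩
      trans := by
        rintro f g l ⟨k, h⟩ ⟨k', h'⟩
        exact ⟨k' * k, fun x => by rw [h', h]; group⟩ }

/-- Morphisms of `Out`: conjugacy classes of surjective group homomorphisms. -/
def Hom (G K : OutCat) : Type := Quotient (conjSetoid G K)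

/-- The conjugacy class of a surjective homomorphism. -/
def Hom.mk {G K : OutCat} (f : Epim G K) : Hom G K := Quotient.mk (conjSetoid G K) f

/-- Composition of conjugacy classes. -/
def Hom.comp {G K M : OutCat} : Hom G K → Hom K M → Hom G M :=
  Quotient.map₂ (sa := conjSetoid G K) (sb := conjSetoid K M) (sc := conjSetoid G M)
    (fun f g => ⟨g.1.comp f.1, g.2.comp f.2⟩) (by
      rintro f f' ⟨k, h⟩ g g' ⟨m, h'⟩
      refine ⟨m * g.1 k, fun x => ?_⟩
      simp only [MonoidHom.comp_apply, h', h, map_mul, map_inv]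
      group)

instance : Category OutCat where
  Hom := Hom
  id G := Hom.mk ⟨MonoidHom.id G, Function.surjective_id⟩
  comp := Hom.comp
  id_comp f := by
    induction f using Quotient.inductionOn
    rfl
  comp_id f := by
    induction f using Quotient.inductionOn
    rfl
  assoc f g h := by
    induction f using Quotient.inductionOn
    induction g using Quotient.inductionOn
    induction h using Quotient.inductionOn
    rfl

/-- The morphism of `Out` represented by a surjective homomorphism. -/
def mkHom {G K : OutCat} (f : Epim G K) : G ⟶ K := Hom.mk f

lemma mkHom_comp {G K M : OutCat} (f : Epim G K) (g : Epim K M) :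
    mkHom f ≫ mkHom g = mkHom ⟨g.1.comp f.1, g.2.comp f.2⟩ := rfl

lemma mkHom_id (G : OutCat) : mkHom ⟨MonoidHom.id G, Function.surjective_id⟩ = 𝟙 G := rfl

lemma mkHom_surjective {G K : OutCat} (f : G ⟶ K) : ∃ g : Epim G K, mkHom g = f :=
  Quotient.exists_rep f

lemma mkHom_eq_iff {G K : OutCat} (f g : Epim G K) :
    mkHom f = mkHom g ↔ ∃ k : K, ∀ x, g.1 x = k * f.1 x * k⁻¹ :=
  Quotient.eq (r := conjSetoid G K)

end OutCat

/-- The category of `ℚ[Out^op]`-modules. -/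
abbrev OutMod : Type 1 := OutCatᵒᵖ ⥤ ModuleCat.{0} ℚ

namespace OutMod

/-- A submodule of a `ℚ[Out^op]`-module. -/
structure Sub (P : OutMod) where
  carrier (G : OutCatᵒᵖ) : Submodule ℚ (P.obj G)
  le_comap {G K : OutCatᵒᵖ} (f : G ⟶ K) : carrier G ≤ (carrier K).comap (P.map f).hom

/-- The quotient of a `ℚ[Out^op]`-module by a submodule. -/
def Sub.quotient {P : OutMod} (N : Sub P) : OutMod where
  obj G := ModuleCat.of ℚ (P.obj G ⧸ N.carrier G)
  map f := ModuleCat.ofHom (Submodule.mapQ _ _ (P.map f).hom (N.le_comap f))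
  map_id G := by
    ext : 1
    apply Submodule.linearMap_qext
    ext x
    simp
  map_comp f g := by
    ext : 1
    apply Submodule.linearMap_qext
    ext x
    simp

/-- The projection onto a quotient. -/
def Sub.proj {P : OutMod} (N : Sub P) : P ⟶ N.quotient where
  app G := ModuleCat.ofHom (Submodule.mkQ (N.carrier G))
  naturality G K f := by
    ext x
    rfl

/-- The map induced on quotients. -/
def Sub.map {P P' : OutMod} (N : Sub P) (N' : Sub P') (f : P ⟶ P')
    (h : ∀ G, N.carrier G ≤ (N'.carrier G).comap (f.app G).hom) : N.quotient ⟶ N'.quotient where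
  app G := ModuleCat.ofHom (Submodule.mapQ _ _ (f.app G).hom (h G))
  naturality G K g := by
    ext : 1
    apply Submodule.linearMap_qext
    ext x
    have := congrArg (Submodule.Quotient.mk (p := N'.carrier K))
      (ConcreteCategory.congr_hom (f.naturality g) x)
    exact this

lemma Sub.proj_map {P P' : OutMod} (N : Sub P) (N' : Sub P') (f : P ⟶ P')
    (h : ∀ G, N.carrier G ≤ (N'.carrier G).comap (f.app G).hom) :
    N.proj ≫ N.map N' f h = f ≫ N'.proj := by
  ext G x
  rfl

lemma Sub.hom_ext {P Q : OutMod} (N : Sub P) {f g : N.quotient ⟶ Q}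
    (h : N.proj ≫ f = N.proj ≫ g) : f = g := by
  ext G x
  obtain ⟨y, rfl⟩ := Submodule.mkQ_surjective (N.carrier G) x
  exact ConcreteCategory.congr_hom (congrArg (fun t => t.app G) h) y

/-- The submodule of the constant module `ℚ` which is everything at the nontrivial groups and `0` at
the trivial groups. -/
def atTrivialSub : Sub ((Functor.const OutCatᵒᵖ).obj (ModuleCat.of ℚ ℚ)) where
  carrier G := ⨆ _ : Nontrivial G.unop, ⊤
  le_comap {G K} f := by
    refine iSup_le fun hG => ?_
    obtain ⟨g, -⟩ := OutCat.mkHom_surjective f.unop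
    have hK : Nontrivial K.unop := g.2.nontrivial
    simp [hK]

/-- The `ℚ[Out^op]`-module which sends trivial groups to `ℚ` and all other finite groups to `0`. -/
def atTrivial : OutMod := atTrivialSub.quotient

end OutMod

/-! ### The subgroup lattice -/

lemma mem_map_conj_iff {G : Type} [Group G] (H : Subgroup G) (g x : G) :
    x ∈ H.map (MulAut.conj g).toMonoidHom ↔ g⁻¹ * x * g ∈ H := by
  refine Subgroup.mem_map_equiv.trans ?_
  rw [MulAut.conj_symm_apply]

/-- The `m`-simplices of `L(G)_n`: chains `H₀ ≤ ⋯ ≤ H_m` of subgroups of `G` of total index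
`[H_m : H₀] ≤ n`. -/
def LChain (n : ℕ∞) (m : SimplexCategory) (G : OutCat) : Type :=
  {c : Fin (m.len + 1) →o Subgroup G // ((c 0).relIndex (c (Fin.last _)) : ℕ∞) ≤ n}

namespace LChain

variable {n : ℕ∞} {m m' : SimplexCategory} {G K M : OutCat}

/-- Conjugation on chains: `d = g c g⁻¹` for some `g`. -/
def conjSetoid (n : ℕ∞) (m : SimplexCategory) (G : OutCat) : Setoid (LChain n m G) where
  r c d := ∃ g : G, ∀ i, d.1 i = (c.1 i).map (MulAut.conj g).toMonoidHom
  iseqv :=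
    { refl := fun c => ⟨1, fun i => by ext x; simp⟩
      symm := by
        rintro c d ⟨g, h⟩
        refine ⟨g⁻¹, fun i => ?_⟩
        ext x
        rw [h, mem_map_conj_iff, mem_map_conj_iff]
        apply iff_of_eq
        congr 1
        group
      trans := by
        rintro c d e ⟨g, h⟩ ⟨g', h'⟩
        refine ⟨g' * g, fun i => ?_⟩
        rw [h', h, Subgroup.map_map]
        ext x
        simp }

/-- The simplicial operators. -/
def pull (f : m' ⟶ m) (c : LChain n m G) : LChain n m' G :=
  ⟨c.1.comp f.toOrderHom, by
    refine le_trans ?_ c.2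
    have h1 : c.1 0 ≤ c.1 (f.toOrderHom 0) := c.1.monotone (Fin.zero_le _)
    have h2 : c.1 (f.toOrderHom (Fin.last _)) ≤ c.1 (Fin.last _) := c.1.monotone (Fin.le_last _)
    have hne : ∀ A B : Subgroup G, A.relIndex B ≠ 0 := fun A B =>
      Subgroup.index_ne_zero_of_finite
    exact_mod_cast (Subgroup.relIndex_le_of_le_left h1 (hne _ _)).trans
      (Subgroup.relIndex_le_of_le_right h2 (hne _ _))⟩

/-- Preimages of chains along surjections. -/
def comap (f : OutCat.Epim G K) (c : LChain n m K) : LChain n m G :=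
  ⟨⟨fun i => (c.1 i).comap f.1, fun _ _ h => Subgroup.comap_mono (c.1.monotone h)⟩, by
    refine le_of_eq_of_le ?_ c.2
    change (((c.1 0).comap f.1).relIndex ((c.1 (Fin.last _)).comap f.1) : ℕ∞) = _
    rw [Subgroup.relIndex_comap, Subgroup.map_comap_eq_self_of_surjective f.2]⟩

end LChain

/-- The `m`-simplices of `L(G)_n / G`. -/
def LClass (n : ℕ∞) (m : SimplexCategory) (G : OutCat) : Type :=
  Quotient (LChain.conjSetoid n m G)

namespace LClass

variable {n : ℕ∞} {m m' : SimplexCategory} {G K M : OutCat}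

/-- The conjugacy class of a chain. -/
def mk (c : LChain n m G) : LClass n m G := Quotient.mk (LChain.conjSetoid n m G) c

lemma mk_eq_iff (c d : LChain n m G) :
    mk c = mk d ↔ ∃ g : G, ∀ i, d.1 i = (c.1 i).map (MulAut.conj g).toMonoidHom :=
  Quotient.eq (r := LChain.conjSetoid n m G)

lemma mk_surjective (x : LClass n m G) : ∃ c, mk c = x := Quotient.exists_rep x

/-- The simplicial operators on conjugacy classes. -/
def pull (f : m' ⟶ m) : LClass n m G → LClass n m' G :=
  Quotient.map (sa := LChain.conjSetoid n m G) (sb := LChain.conjSetoid n m' G) (LChain.pull f) (by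
    rintro c d ⟨g, h⟩
    exact ⟨g, fun i => h _⟩)

/-- Restriction along conjugacy classes of surjections: `ψ^*[H₀ ≤ ⋯ ≤ H_m]` is
`[ψ⁻¹(H₀) ≤ ⋯ ≤ ψ⁻¹(H_m)]`. -/
def comap : (G ⟶ K) → LClass n m K → LClass n m G :=
  Quotient.map₂ (sa := OutCat.conjSetoid G K) (sb := LChain.conjSetoid n m K)
    (sc := LChain.conjSetoid n m G) LChain.comap (by
    rintro f f' ⟨k, h⟩ c d ⟨k', h'⟩
    obtain ⟨g, hg⟩ := f.2 (k⁻¹ * k')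
    refine ⟨g, fun i => ?_⟩
    change (d.1 i).comap f'.1 = ((c.1 i).comap f.1).map (MulAut.conj g).toMonoidHom
    rw [h']
    ext x
    simp only [Subgroup.mem_comap, mem_map_conj_iff, map_mul, map_inv, h, hg]
    apply iff_of_eq
    congr 1
    group)

lemma comap_mkHom_mk (f : OutCat.Epim G K) (c : LChain n m K) :
    comap (OutCat.mkHom f) (mk c) = mk (LChain.comap f c) := rfl

lemma pull_mk (f : m' ⟶ m) (c : LChain n m G) : pull f (mk c) = mk (LChain.pull f c) := rfl

end LClass

/-- The `Out^op`-diagram of simplicial sets `G ↦ L(G)_n / G`. -/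
def latticeQuot (n : ℕ∞) : OutCatᵒᵖ ⥤ SSet.{0} where
  obj G :=
    { obj := fun m => LClass n m.unop G.unop
      map := fun f => ↾(LClass.pull f.unop)
      map_id := fun m => by
        ext x
        obtain ⟨c, rfl⟩ := LClass.mk_surjective x
        rfl
      map_comp := fun f g => by
        ext x
        obtain ⟨c, rfl⟩ := LClass.mk_surjective x
        rfl }
  map f :=
    { app := fun m => ↾(LClass.comap f.unop)
      naturality := fun m m' g => by
        ext x
        obtain ⟨c, rfl⟩ := LClass.mk_surjective x
        obtain ⟨f', hf⟩ := OutCat.mkHom_surjective f.unop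
        rw [← hf]
        rfl }
  map_id G := by
    ext m x
    obtain ⟨c, rfl⟩ := LClass.mk_surjective x
    rfl
  map_comp f g := by
    ext m x
    obtain ⟨c, rfl⟩ := LClass.mk_surjective x
    obtain ⟨f', hf⟩ := OutCat.mkHom_surjective f.unop
    obtain ⟨g', hg⟩ := OutCat.mkHom_surjective g.unop
    simp only [unop_comp, ← hf, ← hg]
    rfl

/-! ### The complex -/

/-- The simplicial `ℚ[Out^op]`-module `ℚ[L(-)_n / -]`. -/
def latticeModule (n : ℕ∞) : SimplicialObject OutMod :=
  (latticeQuot n).flip ⋙ (Functor.whiskeringRight _ _ _).obj (ModuleCat.free ℚ)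

/-- The `k`-simplices of `L(G)_n / G` which are degenerate or lie in the subcomplex of chains not
ending in `G`. These vanish in the normalized chains on the pointed simplicial set obtained from
`L(G)_n / G` by collapsing this subcomplex to the base point. -/
def nullSimplices (n : ℕ∞) (k : ℕ) (G : OutCatᵒᵖ) : Set (((latticeQuot n).obj G) _⦋k⦌) :=
  ((latticeQuot n).obj G).degenerate k ∪
    {x | ∃ c : LChain n ⦋k⦌ G.unop, LClass.mk c = x ∧ c.1 (Fin.last _) ≠ ⊤}

/-- The submodule of null chains. -/
def nullSub (n : ℕ∞) (k : ℕ) : OutMod.Sub ((latticeModule n).obj (op ⦋k⦌)) where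
  carrier G := Submodule.span ℚ (ModuleCat.freeMk '' nullSimplices n k G)
  le_comap {G K} f := by
    rw [Submodule.span_le]
    rintro _ ⟨x, hx, rfl⟩
    refine Submodule.subset_span ⟨((latticeQuot n).map f).app _ x, ?_, ?_⟩
    · rcases hx with hx | ⟨c, rfl, hc⟩
      · exact Or.inl (SSet.degenerate_app_apply hx _)
      · obtain ⟨f', hf⟩ := OutCat.mkHom_surjective f.unop
        refine Or.inr ⟨LChain.comap f' c, ?_, ?_⟩
        · rw [← LClass.comap_mkHom_mk, hf]
          rfl
        · intro h
          apply hc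
          have h' : (c.1 (Fin.last _)).comap f'.1 = ⊤ := h
          rw [← Subgroup.map_comap_eq_self_of_surjective f'.2 (c.1 (Fin.last _)), h',
            Subgroup.map_top_of_surjective _ f'.2]
    · exact (ModuleCat.free_map_apply _ _).symm

lemma objD_freeMk (n : ℕ∞) (k : ℕ) (G : OutCatᵒᵖ) (x : ((latticeQuot n).obj G) _⦋k + 1⦌) :
    (AlgebraicTopology.AlternatingFaceMapComplex.objD (latticeModule n) k).app G
      (ModuleCat.freeMk x) =
    ∑ i : Fin (k + 2), (-1 : ℤ) ^ (i : ℕ) •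
      (ModuleCat.freeMk (((latticeQuot n).obj G).δ i x) :
        ((latticeModule n).obj (op ⦋k⦌)).obj G) := by
  rw [AlgebraicTopology.AlternatingFaceMapComplex.objD, NatTrans.app_sum]
  refine (LinearMap.congr_fun (ModuleCat.hom_sum _ _) _).trans ?_
  refine (LinearMap.sum_apply _ _ _).trans (Finset.sum_congr rfl fun i _ => ?_)
  rw [NatTrans.app_zsmul, ModuleCat.hom_zsmul]
  refine (LinearMap.smul_apply _ _ _).trans ?_
  congr 1
  exact ModuleCat.free_map_apply _ _

lemma null_face (n : ℕ∞) (k : ℕ) (G : OutCatᵒᵖ) :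
    (nullSub n (k + 1)).carrier G ≤ ((nullSub n k).carrier G).comap
      (((AlgebraicTopology.AlternatingFaceMapComplex.objD (latticeModule n) k).app G).hom) := by
  change Submodule.span ℚ _ ≤ _
  rw [Submodule.span_le]
  rintro _ ⟨x, hx, rfl⟩
  change (AlgebraicTopology.AlternatingFaceMapComplex.objD (latticeModule n) k).app G
    (ModuleCat.freeMk x) ∈ (nullSub n k).carrier G
  rw [objD_freeMk]
  rcases hx with hx | ⟨c, rfl, hc⟩
  · rw [SSet.degenerate_eq_iUnion_range_σ] at hx
    simp only [Set.mem_iUnion, Set.mem_range] at hx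
    obtain ⟨j, y, rfl⟩ := hx
    have hself : ((latticeQuot n).obj G).δ j.castSucc (((latticeQuot n).obj G).σ j y) = y :=
      ConcreteCategory.congr_hom (((latticeQuot n).obj G).δ_comp_σ_self (i := j)) y
    have hsucc : ((latticeQuot n).obj G).δ j.succ (((latticeQuot n).obj G).σ j y) = y :=
      ConcreteCategory.congr_hom (((latticeQuot n).obj G).δ_comp_σ_succ (i := j)) y
    have hne : j.succ ≠ j.castSucc := (Fin.castSucc_lt_succ).ne'
    rw [← Finset.add_sum_erase _ _ (Finset.mem_univ j.castSucc),
      ← Finset.add_sum_erase _ _ (Finset.mem_erase.2 ⟨hne, Finset.mem_univ j.succ⟩),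
      hself, hsucc, ← add_assoc, ← add_smul]
    have hs : ((-1 : ℤ) ^ (j.castSucc : ℕ) + (-1) ^ (j.succ : ℕ)) = 0 := by
      simp [pow_succ]
    rw [hs, zero_smul, zero_add]
    refine Submodule.sum_mem _ fun i hi => zsmul_mem ?_ _
    simp only [Finset.mem_erase, Finset.mem_univ, and_true] at hi
    refine Submodule.subset_span ⟨_, Or.inl ?_, rfl⟩
    obtain ⟨m, rfl⟩ : ∃ m, k = m + 1 := by
      cases k with
      | zero =>
        exfalso
        obtain ⟨h1, h2⟩ := hi
        fin_cases j
        fin_cases i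
        · exact h2 rfl
        · exact h1 rfl
      | succ m => exact ⟨m, rfl⟩
    rcases lt_or_gt_of_ne hi.2 with h | h
    · have hj : j ≠ 0 := by
        rintro rfl
        simp at h
      obtain ⟨j', rfl⟩ := Fin.exists_succ_eq.2 hj
      obtain ⟨i', rfl⟩ := Fin.exists_castSucc_eq.2 (h.trans_le (Fin.le_last _)).ne
      have hle : i' ≤ j'.castSucc := by
        simp only [Fin.lt_def, Fin.le_def, Fin.val_castSucc, Fin.val_succ] at h ⊢
        lia
      have := ConcreteCategory.congr_hom (((latticeQuot n).obj G).δ_comp_σ_of_le hle) y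
      simp only [CategoryTheory.comp_apply] at this
      rw [this]
      exact SSet.σ_mem_degenerate _ _ _
    · have hlt : j.succ < i := by
        have h1 := hi.1
        simp only [Fin.lt_def, Fin.val_castSucc, Fin.val_succ, ne_eq, Fin.ext_iff] at h h1 ⊢
        lia
      have := ConcreteCategory.congr_hom (((latticeQuot n).obj G).δ_comp_σ_of_gt' hlt) y
      simp only [CategoryTheory.comp_apply] at this
      rw [this]
      exact SSet.σ_mem_degenerate _ _ _
  · refine Submodule.sum_mem _ fun i _ => zsmul_mem ?_ _
    refine Submodule.subset_span ⟨_, Or.inr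
      ⟨LChain.pull (SimplexCategory.δ i) c, rfl, fun h => hc (top_le_iff.1 ?_)⟩, rfl⟩
    rw [← h]
    exact c.1.monotone (Fin.le_last _)

/-- The complex `𝒞L̃_n` of `ℚ[Out^op]`-modules: the normalized rational chains on the `Out^op`-diagram
of pointed simplicial sets `G ↦ L̃(G)_n / G`. -/
def CL (n : ℕ∞) : ChainComplex OutMod ℕ :=
  ChainComplex.of (fun k => (nullSub n k).quotient)
    (fun k => (nullSub n (k + 1)).map (nullSub n k)
      (AlgebraicTopology.AlternatingFaceMapComplex.objD (latticeModule n) k) (null_face n k))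
    (fun k => by
      apply OutMod.Sub.hom_ext
      rw [← Category.assoc, OutMod.Sub.proj_map, Category.assoc, OutMod.Sub.proj_map,
        ← Category.assoc, AlgebraicTopology.AlternatingFaceMapComplex.d_squared]
      simp)

/-! ### Simple chains -/

/-- Simple chains `H₀ < ⋯ < H_k` of finite groups with `[H_k : H₀] ≤ n`, where `H_k` is regarded as
the ambient group: `H₀` contains no nontrivial normal subgroup of `H_k`. -/
structure SimpleChain (n : ℕ∞) (k : ℕ) where
  top : OutCat
  chain : Fin (k + 1) → Subgroup top
  strictMono : StrictMono chain
  last_eq : chain (Fin.last k) = ⊤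
  simple : ∀ N : Subgroup top, N.Normal → N ≤ chain 0 → N = ⊥
  index_le : ((chain 0).index : ℕ∞) ≤ n

namespace SimpleChain

variable {n : ℕ∞} {k : ℕ}

/-- Isomorphism of chains. -/
def isoSetoid (n : ℕ∞) (k : ℕ) : Setoid (SimpleChain n k) where
  r c d := ∃ e : c.top ≃* d.top, ∀ i, (c.chain i).map e.toMonoidHom = d.chain i
  iseqv :=
    { refl := fun c => ⟨MulEquiv.refl _, fun i => Subgroup.map_id _⟩
      symm := by
        rintro c d ⟨e, h⟩
        refine ⟨e.symm, fun i => ?_⟩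
        rw [← h, Subgroup.map_map]
        ext x
        simp
      trans := by
        rintro c d b ⟨e, h⟩ ⟨e', h'⟩
        refine ⟨e.trans e', fun i => ?_⟩
        rw [← h', ← h, Subgroup.map_map]
        rfl }

/-- A simple chain as a simplex of `L(H_k)_n`. -/
def toLChain (c : SimpleChain n k) : LChain n ⦋k⦌ c.top :=
  ⟨⟨c.chain, c.strictMono.monotone⟩, by
    change ((c.chain 0).relIndex (c.chain (Fin.last k)) : ℕ∞) ≤ n
    rw [c.last_eq, Subgroup.relIndex_top_right]
    exact c.index_le⟩

/-- An isomorphism of finite groups as a surjection. -/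
def _root_.OutCat.ofEquiv {G K : OutCat} (e : G ≃* K) : OutCat.Epim G K :=
  ⟨e.toMonoidHom, e.surjective⟩

/-- The group `Out(H₀ < ⋯ < H_k)` of conjugacy classes of automorphisms of `H_k` which map the chain
to a conjugate of itself. -/
def outGroup (c : SimpleChain n k) : Subgroup (Aut c.top) where
  carrier := {α | ∃ e : c.top ≃* c.top, OutCat.mkHom (OutCat.ofEquiv e) = α.hom ∧
    ∃ g : c.top, ∀ i,
      (c.chain i).map e.toMonoidHom = (c.chain i).map (MulAut.conj g).toMonoidHom}
  one_mem' := ⟨MulEquiv.refl _, rfl, 1, fun i => by ext x; simp⟩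
  mul_mem' := by
    rintro α β ⟨e, he, g, hg⟩ ⟨e', he', g', hg'⟩
    refine ⟨e'.trans e, ?_, e g' * g, fun i => ?_⟩
    · change _ = β.hom ≫ α.hom
      rw [← he, ← he']
      rfl
    · have h1 : (c.chain i).map (e'.trans e).toMonoidHom =
          ((c.chain i).map e'.toMonoidHom).map e.toMonoidHom := by
        rw [Subgroup.map_map]; rfl
      have h2 : ((c.chain i).map (MulAut.conj g').toMonoidHom).map e.toMonoidHom =
          ((c.chain i).map e.toMonoidHom).map (MulAut.conj (e g')).toMonoidHom := by
        rw [Subgroup.map_map, Subgroup.map_map]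
        congr 1
        ext x
        simp
      rw [h1, hg', h2, hg, Subgroup.map_map]
      congr 1
      ext x
      simp [mul_assoc]
  inv_mem' := by
    rintro α ⟨e, he, g, hg⟩
    refine ⟨e.symm, ?_, e.symm g⁻¹, fun i => ?_⟩
    · let a : c.top ≅ c.top := α
      change _ = a.inv
      change _ = a.hom at he
      rw [← cancel_epi a.hom, a.hom_inv_id, ← he, OutCat.mkHom_comp, ← OutCat.mkHom_id]
      congr 1
      ext x
      simp [OutCat.ofEquiv]
    · apply Subgroup.map_injective (f := e.toMonoidHom) e.injective
      have h2 : ((c.chain i).map (MulAut.conj (e.symm g⁻¹)).toMonoidHom).map e.toMonoidHom =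
          ((c.chain i).map e.toMonoidHom).map (MulAut.conj g⁻¹).toMonoidHom := by
        rw [Subgroup.map_map, Subgroup.map_map]
        congr 1
        ext x
        simp
      rw [h2, hg, Subgroup.map_map, Subgroup.map_map]
      congr 1
      ext x
      simp [mul_assoc]

/-- The relations `α ∘ ψ ~ ψ` for `α` in `Out(H₀ < ⋯ < H_k)` in the representable module
`ℚ[Out(-, H_k)]`. -/
def orbitSub (c : SimpleChain n k) :
    OutMod.Sub (yoneda.obj c.top ⋙ ModuleCat.free ℚ) where
  carrier G := Submodule.span ℚ {v | ∃ α ∈ c.outGroup, ∃ ψ : G.unop ⟶ c.top,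
    v = ModuleCat.freeMk (ψ ≫ α.hom) - ModuleCat.freeMk ψ}
  le_comap {G K} f := by
    rw [Submodule.span_le]
    rintro _ ⟨α, hα, ψ, rfl⟩
    refine Submodule.subset_span ⟨α, hα, f.unop ≫ ψ, ?_⟩
    simp only [Functor.comp_map, map_sub]
    erw [ModuleCat.free_map_apply, ModuleCat.free_map_apply]
    simp

/-- The orbit module `ℚ[Out(-, H_k)] / Out(H₀ < ⋯ < H_k)`. -/
def orbitModule (c : SimpleChain n k) : OutMod := c.orbitSub.quotient

/-- The map `ℚ[Out(-, H_k)] ⟶ ℚ[(L(-)_n / -)_k]` sending `ψ : G ↠ H_k` to the chain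
`ψ⁻¹(H₀) < ⋯ < ψ⁻¹(H_k) = G`. -/
def preimageMap (c : SimpleChain n k) :
    yoneda.obj c.top ⋙ ModuleCat.free ℚ ⟶ (latticeModule n).obj (op ⦋k⦌) :=
  Functor.whiskerRight
    (yonedaEquiv.symm (LClass.mk c.toLChain) :
      yoneda.obj c.top ⟶ (latticeQuot n).flip.obj (op ⦋k⦌)) (ModuleCat.free ℚ)

lemma preimageMap_freeMk (c : SimpleChain n k) (G : OutCatᵒᵖ) (ψ : G.unop ⟶ c.top) :
    c.preimageMap.app G (ModuleCat.freeMk ψ) =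
      ModuleCat.freeMk (LClass.comap ψ (LClass.mk c.toLChain)) :=
  ModuleCat.free_map_apply _ _

lemma comap_outGroup (c : SimpleChain n k) {α : Aut c.top} (hα : α ∈ c.outGroup) :
    LClass.comap α.hom (LClass.mk c.toLChain) = LClass.mk c.toLChain := by
  obtain ⟨e, he, g, hg⟩ := hα
  rw [← he, LClass.comap_mkHom_mk, LClass.mk_eq_iff]
  refine ⟨e.symm g, fun i => ?_⟩
  change c.chain i = ((c.chain i).comap e.toMonoidHom).map (MulAut.conj (e.symm g)).toMonoidHom
  ext x
  have hx : e x ∈ (c.chain i).map e.toMonoidHom ↔ x ∈ c.chain i :=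
    Subgroup.mem_map_equiv.trans (by simp)
  rw [mem_map_conj_iff, Subgroup.mem_comap, ← hx, hg, mem_map_conj_iff]
  simp

/-- The map `ℚ[Out(-, H_k)] / Out(H₀ < ⋯ < H_k) ⟶ (𝒞L̃_n)_k` sending the class of
`ψ : G ↠ H_k` to the class of the chain `ψ⁻¹(H₀) < ⋯ < ψ⁻¹(H_k) = G`. -/
def orbitMap (c : SimpleChain n k) : c.orbitModule ⟶ (CL n).X k :=
  c.orbitSub.map (nullSub n k) c.preimageMap (fun G => by
    change Submodule.span ℚ _ ≤ _
    rw [Submodule.span_le]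
    rintro _ ⟨α, hα, ψ, rfl⟩
    have h : LClass.comap (ψ ≫ α.hom) (LClass.mk c.toLChain) =
        LClass.comap ψ (LClass.mk c.toLChain) := by
      conv_rhs => rw [← c.comap_outGroup hα]
      exact ConcreteCategory.congr_hom
        (congrArg (fun t => t.app (op ⦋k⦌)) ((latticeQuot n).map_comp α.hom.op ψ.op)) _
    change c.preimageMap.app G _ ∈ (nullSub n k).carrier G
    rw [map_sub]
    refine (congrArg (fun t => t ∈ (nullSub n k).carrier G) (sub_eq_zero.2 ?_)).mpr
      (Submodule.zero_mem _)
    exact (c.preimageMap_freeMk G _).trans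
      ((congrArg ModuleCat.freeMk h).trans (c.preimageMap_freeMk G ψ).symm))

end SimpleChain

/-- Isomorphism classes of simple chains of length `k` and total index at most `n`. -/
def SimpleChainClass (n : ℕ∞) (k : ℕ) : Type 1 := Quotient (SimpleChain.isoSetoid n k)

/-- A chosen representative of an isomorphism class. -/
def SimpleChainClass.rep {n : ℕ∞} {k : ℕ} (x : SimpleChainClass n k) : SimpleChain n k :=
  Quotient.out x

/-- The modules `ℚ[Out(-, H_k)] / Out(H₀ < ⋯ < H_k)`, one for each isomorphism class of simple chains
of total index at most `n`, with their maps to `(𝒞L̃_n)_k`. That this cofan is a colimit means that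
`(𝒞L̃_n)_k` is the direct sum of these modules along these maps. -/
def orbitCofan (n : ℕ∞) (k : ℕ) :
    Cofan (fun x : SimpleChainClass n k => x.rep.orbitModule) :=
  Cofan.mk ((CL n).X k) (fun x => x.rep.orbitMap)

end

noncomputable section

/-! ### Modules over `Out` -/

namespace OutMod

/-! Call a simplex null if it is degenerate or does not end in the whole group. By
`LClass.mk_mem_nullSimplices_iff`, the non-null simplices are the conjugacy classes of strict chains
ending in `G`. Preimage along a surjection preserves and reflects this property
(`LClass.comap_mem_nullSimplices_iff`), so these classes form a presheaf of sets on `Out`, on which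
`(CL n).X k` is free.

Parts (1) and (2): dividing `G` by the normal core of `H₀` exhibits any strict chain ending in `G`
as the preimage of a simple chain (`exists_comap_rep_eq`). The presentation is unique up to an
isomorphism of chains, because simplicity forces the kernel of the surjection to be determined by
the chain (`exists_equiv_of_comap_eq`). Hence the presheaf is a disjoint union of the orbit sets of
`Out(-, H_k)` under `Out(H₀ < ⋯ < H_k)`. Representables are projective by Yoneda. Over `ℚ`,
averaging over the finite group `Out(H₀ < ⋯ < H_k)` makes the orbit module a retract of a
representable, and coproducts of projectives are projective.

Part (3): exactness is tested at one group `G` at a time, so a contraction need not be natural in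
`G`. Adding `⊥` at the bottom of a chain commutes with conjugation and gives such a contraction in
positive degrees (`d_contraction_add`). It requires `n = ∞`, since it enlarges the total index. In
degree `0` the only obstruction is the vertex `⊥`, which is null exactly when `G` is nontrivial. -/

/-- The map induced on a quotient by a map vanishing on the submodule. -/
def Sub.desc {P Q : OutMod} (N : Sub P) (f : P ⟶ Q)
    (h : ∀ G, N.carrier G ≤ LinearMap.ker (f.app G).hom) : N.quotient ⟶ Q where
  app G := ModuleCat.ofHom (Submodule.liftQ _ (f.app G).hom (h G))
  naturality G K g := by
    ext : 1
    apply Submodule.linearMap_qext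
    ext x
    exact ConcreteCategory.congr_hom (f.naturality g) x

lemma Sub.proj_desc {P Q : OutMod} (N : Sub P) (f : P ⟶ Q)
    (h : ∀ G, N.carrier G ≤ LinearMap.ker (f.app G).hom) : N.proj ≫ N.desc f h = f := by
  ext G x
  rfl

lemma Sub.proj_app_surjective {P : OutMod} (N : Sub P) (G : OutCatᵒᵖ) :
    Function.Surjective (N.proj.app G) :=
  Submodule.mkQ_surjective (N.carrier G)

lemma Sub.proj_app_eq_iff {P : OutMod} (N : Sub P) (G : OutCatᵒᵖ) (x y : P.obj G) :
    N.proj.app G x = N.proj.app G y ↔ x - y ∈ N.carrier G :=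
  Submodule.Quotient.eq (N.carrier G)

lemma Sub.proj_app_eq_zero_iff {P : OutMod} (N : Sub P) (G : OutCatᵒᵖ) (x : P.obj G) :
    N.proj.app G x = 0 ↔ x ∈ N.carrier G :=
  Submodule.Quotient.mk_eq_zero (N.carrier G)

variable {F : OutCatᵒᵖ ⥤ Type}

/-- The map out of the free module on a presheaf of sets given by a natural family of functions. -/
def freeHom {E : OutMod} (φ : ∀ G, F.obj G → E.obj G)
    (h : ∀ (G K) (f : G ⟶ K) (x : F.obj G), φ K (F.map f x) = E.map f (φ G x)) :
    F ⋙ ModuleCat.free ℚ ⟶ E where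
  app G := ModuleCat.freeDesc (↾(φ G))
  naturality G K f := by
    apply ModuleCat.free_hom_ext
    intro x
    refine (congrArg (ModuleCat.freeDesc (↾(φ K))) (ModuleCat.free_map_apply _ _)).trans ?_
    refine (ModuleCat.freeDesc_apply _ _).trans ((h G K f x).trans ?_)
    exact congrArg (E.map f) (ModuleCat.freeDesc_apply (↾(φ G)) x).symm

lemma freeHom_freeMk {E : OutMod} (φ : ∀ G, F.obj G → E.obj G)
    (h : ∀ (G K) (f : G ⟶ K) (x : F.obj G), φ K (F.map f x) = E.map f (φ G x))
    (G : OutCatᵒᵖ) (x : F.obj G) :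
    (freeHom φ h).app G (ModuleCat.freeMk x) = φ G x :=
  ModuleCat.freeDesc_apply _ _

lemma free_hom_ext {E : OutMod} {f g : F ⋙ ModuleCat.free ℚ ⟶ E}
    (h : ∀ (G : OutCatᵒᵖ) (x : F.obj G),
      f.app G (ModuleCat.freeMk x) = g.app G (ModuleCat.freeMk x)) : f = g := by
  ext G : 2
  exact ModuleCat.free_hom_ext (h G)

lemma app_surjective_of_epi {P Q : OutMod} (e : P ⟶ Q) [Epi e] (G : OutCatᵒᵖ) :
    Function.Surjective (e.app G) :=
  (ModuleCat.epi_iff_surjective _).1 inferInstance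

/-- Representable modules are projective. -/
instance projective_representable (X : OutCat) :
    Projective (yoneda.obj X ⋙ ModuleCat.free ℚ) where
  factors {E B} f e he := by
    -- Yoneda: a map out of the representable is determined by the image of `𝟙 X`, so it suffices to
    -- lift this one element.
    obtain ⟨y, hy⟩ := app_surjective_of_epi e (op X)
      (f.app (op X) (ModuleCat.freeMk (𝟙 X : (yoneda.obj X).obj (op X))))
    refine ⟨freeHom (fun G (ψ : G.unop ⟶ X) => E.map ψ.op y) ?_, free_hom_ext ?_⟩
    · intro G K g ψ
      exact ConcreteCategory.congr_hom (E.map_comp ψ.op g) y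
    · intro G (ψ : G.unop ⟶ X)
      refine (congrArg (e.app G) (freeHom_freeMk (F := yoneda.obj X) _ _ G ψ)).trans ?_
      refine (ConcreteCategory.congr_hom (e.naturality ψ.op) y).trans ?_
      refine (congrArg (B.map ψ.op) hy).trans ?_
      refine (ConcreteCategory.congr_hom (f.naturality ψ.op) _).symm.trans ?_
      refine congrArg (f.app G) ((ModuleCat.free_map_apply _ _).trans ?_)
      exact congrArg ModuleCat.freeMk (Category.comp_id ψ)

/-- Exactness of a sequence of modules is checked objectwise. -/
lemma exact_of_app (S : ShortComplex OutMod)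
    (h : ∀ (G : OutCatᵒᵖ) (x : S.X₂.obj G), S.g.app G x = 0 → ∃ y, S.f.app G y = x) :
    S.Exact := by
  rw [ShortComplex.exact_iff_isZero_homology]
  refine (Functor.isZero_iff _).2 fun G => ?_
  -- Evaluation at `G` preserves homology.
  refine IsZero.of_iso ?_ (S.mapHomologyIso ((evaluation _ _).obj G)).symm
  rw [← ShortComplex.exact_iff_isZero_homology, ShortComplex.moduleCat_exact_iff]
  exact h G

end OutMod

/-- A coproduct of projective objects, given by a colimit cofan, is projective. -/
lemma projective_of_isColimit_cofan {C : Type*} [Category C] {ι : Type*} {f : ι → C}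
    (c : Cofan f) (hc : IsColimit c) (h : ∀ i, Projective (f i)) : Projective c.pt where
  factors g e he := by
    refine ⟨Cofan.IsColimit.desc hc fun i => Projective.factorThru (c.inj i ≫ g) e, ?_⟩
    refine Cofan.IsColimit.hom_ext hc _ _ fun i => ?_
    rw [← Category.assoc, Cofan.IsColimit.fac, Projective.factorThru_comp]

/-! ### Projectivity of the orbit modules by averaging -/

namespace SimpleChain

variable {n : ℕ∞} {k : ℕ}

/-- Finiteness of morphism sets makes `outGroup` finite, as averaging requires. -/
instance (G K : OutCat) : Finite (G ⟶ K) :=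
  have : Finite (G →* K) := Finite.of_injective _ (DFunLike.coe_injective (F := G →* K))
  Finite.of_surjective _ (fun f => OutCat.mkHom_surjective f)

instance (G : OutCat) : Finite (Aut G) :=
  Finite.of_injective (fun α : Aut G => α.hom) fun _ _ h => Iso.ext h

instance (c : SimpleChain n k) : Fintype c.outGroup := Fintype.ofFinite _

/-- Averaging over the group of outer automorphisms of a simple chain. -/
def average (c : SimpleChain n k) :
    yoneda.obj c.top ⋙ ModuleCat.free ℚ ⟶ yoneda.obj c.top ⋙ ModuleCat.free ℚ :=
  OutMod.freeHom (fun G (ψ : G.unop ⟶ c.top) => (Fintype.card c.outGroup : ℚ)⁻¹ •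
      ∑ α : c.outGroup, (ModuleCat.freeMk (ψ ≫ α.1.hom) : (ModuleCat.free ℚ).obj (G.unop ⟶ c.top)))
    (by
      intro G K f ψ
      refine Eq.trans ?_ (map_smul ((yoneda.obj c.top ⋙ ModuleCat.free ℚ).map f).hom _ _).symm
      congr 1
      refine Eq.trans ?_ (map_sum ((yoneda.obj c.top ⋙ ModuleCat.free ℚ).map f).hom _ _).symm
      refine Finset.sum_congr rfl fun α _ => ?_
      refine Eq.trans ?_ (ModuleCat.free_map_apply _ _).symm
      exact congrArg ModuleCat.freeMk (Category.assoc _ _ _))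

lemma average_freeMk (c : SimpleChain n k) (G : OutCatᵒᵖ) (ψ : G.unop ⟶ c.top) :
    c.average.app G (ModuleCat.freeMk ψ) = (Fintype.card c.outGroup : ℚ)⁻¹ •
      ∑ α : c.outGroup,
        (ModuleCat.freeMk (ψ ≫ α.1.hom) : (ModuleCat.free ℚ).obj (G.unop ⟶ c.top)) :=
  OutMod.freeHom_freeMk (F := yoneda.obj c.top) _ _ G ψ

/-- The averaging section of the projection onto the orbit module. -/
def orbitSection (c : SimpleChain n k) :
    c.orbitSub.quotient ⟶ yoneda.obj c.top ⋙ ModuleCat.free ℚ :=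
  c.orbitSub.desc c.average (fun G => by
    change Submodule.span ℚ _ ≤ _
    rw [Submodule.span_le]
    rintro _ ⟨α, hα, ψ, rfl⟩
    change c.average.app G _ = 0
    rw [map_sub, sub_eq_zero]
    refine (c.average_freeMk G _).trans (Eq.trans ?_ (c.average_freeMk G ψ).symm)
    congr 1
    -- In `Aut`, the product `β * α` is `α ≫ β`, so precomposing with `α` is right multiplication on
    -- the index.
    refine Fintype.sum_equiv (Equiv.mulRight ⟨α, hα⟩) _ _ fun β => ?_
    exact congrArg ModuleCat.freeMk (Category.assoc _ _ _))

lemma orbitSection_proj (c : SimpleChain n k) : c.orbitSection ≫ c.orbitSub.proj = 𝟙 _ := by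
  apply OutMod.Sub.hom_ext
  rw [← Category.assoc, orbitSection, OutMod.Sub.proj_desc]
  refine OutMod.free_hom_ext fun G (ψ : G.unop ⟶ c.top) => ?_
  change c.orbitSub.proj.app G (c.average.app G (ModuleCat.freeMk ψ)) =
    c.orbitSub.proj.app G (ModuleCat.freeMk ψ)
  rw [c.average_freeMk G ψ]
  refine (map_smul (c.orbitSub.proj.app G).hom _ _).trans ?_
  rw [map_sum]
  have h : ∀ α : c.outGroup, (c.orbitSub.proj.app G).hom
      (ModuleCat.freeMk (ψ ≫ α.1.hom) : (ModuleCat.free ℚ).obj (G.unop ⟶ c.top)) =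
      c.orbitSub.proj.app G (ModuleCat.freeMk ψ) := fun α =>
    (c.orbitSub.proj_app_eq_iff G _ _).2 (Submodule.subset_span ⟨α.1, α.2, ψ, rfl⟩)
  -- Every summand has the class of `ψ`, so the sum is the group order times it; this order is
  -- invertible in `ℚ`.
  rw [Finset.sum_congr rfl fun α _ => h α, Finset.sum_const, Finset.card_univ,
    ← Nat.cast_smul_eq_nsmul ℚ, smul_smul, inv_mul_cancel₀, one_smul]
  exact Nat.cast_ne_zero.2 Fintype.card_ne_zero

/-- The orbit modules are projective. -/
lemma projective_orbitModule (c : SimpleChain n k) : Projective c.orbitModule :=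
  Retract.projective ⟨c.orbitSection, c.orbitSub.proj, c.orbitSection_proj⟩

end SimpleChain

/-! ### Non-degenerate simplices -/

namespace LClass

variable {n : ℕ∞} {k : ℕ} {G K : OutCat}

/-- The simplices which vanish in `𝒞L̃_n` are the classes of the chains which are not strict or do
not end in the whole group. -/
lemma mk_mem_nullSimplices_iff (c : LChain n ⦋k⦌ G) :
    mk c ∈ nullSimplices n k (op G) ↔ ¬ (StrictMono c.1 ∧ c.1 (Fin.last k) = ⊤) := by
  constructor
  · rintro (h | ⟨d, hd, hne⟩) ⟨hc, hl⟩
    · cases k with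
      | zero =>
        rw [SSet.degenerate_zero] at h
        exact h
      | succ k =>
        rw [SSet.degenerate_eq_iUnion_range_σ] at h
        obtain ⟨j, y, hy⟩ := Set.mem_iUnion.1 h
        obtain ⟨d, rfl⟩ := mk_surjective y
        -- Degeneracy holds for the conjugacy class, so `c` is only conjugate to a degenerate chain;
        -- its members at `j` and `j + 1` still coincide.
        obtain ⟨g, hg⟩ := (mk_eq_iff (LChain.pull (SimplexCategory.σ j) d) c).1 hy
        refine (hc (Fin.castSucc_lt_succ (i := j))).ne ((hg _).trans (Eq.trans ?_ (hg _).symm))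
        congr 1
        change d.1 (j.predAbove j.castSucc) = d.1 (j.predAbove j.succ)
        simp
    · obtain ⟨g, hg⟩ := (mk_eq_iff c d).1 hd.symm
      refine hne ((hg _).trans ?_)
      change (c.1 (Fin.last k)).map _ = _
      rw [hl]
      exact Subgroup.map_top_of_surjective _ (MulAut.conj g).surjective
  · intro h
    by_cases hl : c.1 (Fin.last k) = ⊤
    · left
      have hs : ¬ StrictMono c.1 := fun hs => h ⟨hs, hl⟩
      cases k with
      | zero => exact absurd (Subsingleton.strictMono (α := Fin 1) _) hs
      | succ k =>
        have hs' : ¬ ∀ i : Fin (k + 1), c.1 i.castSucc < c.1 i.succ := fun h' =>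
          hs (Fin.strictMono_iff_lt_succ.2 h')
        push Not at hs'
        obtain ⟨j, hj⟩ := hs'
        have hj' : c.1 j.castSucc = c.1 j.succ :=
          (c.1.monotone Fin.castSucc_lt_succ.le).eq_of_not_lt hj
        -- A chain that repeats at `j` is recovered by deleting its entry `j + 1` and then doubling
        -- entry `j`.
        have he : mk c = pull (SimplexCategory.σ j) (pull (SimplexCategory.δ j.succ) (mk c)) := by
          refine congrArg mk (Subtype.ext (OrderHom.ext _ _ (funext fun i => ?_)))
          change c.1 i = c.1 (j.succ.succAbove (j.predAbove i))
          by_cases hi : i = j.succ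
          · subst hi
            rw [← hj']
            congr 1
            simp
          · congr 1
            exact (Fin.succ_succAbove_predAbove hi).symm
        rw [he]
        exact SSet.σ_mem_degenerate ((latticeQuot n).obj (op G)) j
          (pull (SimplexCategory.δ j.succ) (mk c))
    · exact Or.inr ⟨c, rfl, hl⟩

/-- Preimage along a surjection is an order embedding of subgroup lattices that preserves `⊤`. The
reflecting direction is what lets non-null simplices restrict to non-null ones. -/
lemma comap_mem_nullSimplices_iff (f : G ⟶ K) (y : LClass n ⦋k⦌ K) :
    comap f y ∈ nullSimplices n k (op G) ↔ y ∈ nullSimplices n k (op K) := by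
  obtain ⟨c, rfl⟩ := mk_surjective y
  obtain ⟨f, rfl⟩ := OutCat.mkHom_surjective f
  rw [comap_mkHom_mk, mk_mem_nullSimplices_iff, mk_mem_nullSimplices_iff, not_iff_not]
  have hinj := Subgroup.comap_injective f.2
  refine and_congr ⟨fun h i j hij => ?_, fun h i j hij => ?_⟩ ?_
  · exact (Subgroup.comap_lt_comap_of_surjective f.2).1 (h hij)
  · exact (Subgroup.comap_lt_comap_of_surjective f.2).2 (h hij)
  · rw [← hinj.eq_iff, Subgroup.comap_top]
    rfl

lemma comap_comp {M : OutCat} {m : SimplexCategory} (f : G ⟶ K) (g : K ⟶ M) (y : LClass n m M) :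
    comap (f ≫ g) y = comap f (comap g y) := by
  obtain ⟨c, rfl⟩ := mk_surjective y
  obtain ⟨f, rfl⟩ := OutCat.mkHom_surjective f
  obtain ⟨g, rfl⟩ := OutCat.mkHom_surjective g
  rfl

end LClass

/-! ### Decomposition into orbit modules -/

namespace SimpleChain

variable {n : ℕ∞} {k : ℕ} {G : OutCat}

lemma mk_toLChain_notMem_nullSimplices (c : SimpleChain n k) :
    LClass.mk c.toLChain ∉ nullSimplices n k (op c.top) := by
  rw [LClass.mk_mem_nullSimplices_iff, not_not]
  exact ⟨c.strictMono, c.last_eq⟩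

/-- The simple chain obtained from a strict chain ending in the whole group by dividing out the
normal core of its smallest member. -/
def ofLChain (c : LChain n ⦋k⦌ G) (hc : StrictMono c.1) (hl : c.1 (Fin.last k) = ⊤) :
    SimpleChain n k :=
  -- The kernel of the quotient map is the core of `c.1 0`, which lies in every member of the chain.
  have hcomap (i) : ((c.1 i).map (QuotientGroup.mk' (c.1 0).normalCore)).comap
      (QuotientGroup.mk' (c.1 0).normalCore) = c.1 i := by
    rw [Subgroup.comap_map_eq_self]
    rw [QuotientGroup.ker_mk']
    exact (Subgroup.normalCore_le _).trans (c.1.monotone (Fin.zero_le _))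
  have hsurj := QuotientGroup.mk'_surjective (c.1 0).normalCore
  { top := OutCat.of (G ⧸ (c.1 0).normalCore)
    chain i := (c.1 i).map (QuotientGroup.mk' (c.1 0).normalCore)
    strictMono := fun i j h => by
      rw [← Subgroup.comap_lt_comap_of_surjective hsurj]
      exact (hcomap i).trans_lt ((hc h).trans_eq (hcomap j).symm)
    last_eq := by
      refine (congrArg (Subgroup.map _) hl).trans (Subgroup.map_top_of_surjective _ hsurj)
    simple := fun N hN h => by
      -- The preimage of `N` is normal and contained in `c.1 0`, hence in its core, which dies in
      -- the quotient.
      have h1 : N.comap (QuotientGroup.mk' (c.1 0).normalCore) ≤ (c.1 0).normalCore :=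
        Subgroup.normal_le_normalCore.2 ((Subgroup.comap_mono h).trans (hcomap 0).le)
      rw [← Subgroup.map_comap_eq_self_of_surjective hsurj N, eq_bot_iff]
      refine (Subgroup.map_mono h1).trans (le_of_eq ?_)
      exact QuotientGroup.map_mk'_self _
    index_le := by
      refine le_of_eq_of_le (congrArg Nat.cast ?_) c.2
      refine (Subgroup.index_comap_of_surjective _ hsurj).symm.trans ?_
      refine (congrArg Subgroup.index (hcomap 0)).trans ?_
      change _ = (c.1 0).relIndex (c.1 (Fin.last k))
      rw [hl, Subgroup.relIndex_top_right] }

lemma exists_comap_ofLChain (c : LChain n ⦋k⦌ G) (hc : StrictMono c.1)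
    (hl : c.1 (Fin.last k) = ⊤) :
    ∃ f : OutCat.Epim G (ofLChain c hc hl).top, LChain.comap f (ofLChain c hc hl).toLChain = c := by
  refine ⟨⟨QuotientGroup.mk' (c.1 0).normalCore, QuotientGroup.mk'_surjective _⟩,
    Subtype.ext (OrderHom.ext _ _ (funext fun i => ?_))⟩
  change ((c.1 i).map (QuotientGroup.mk' (c.1 0).normalCore)).comap
      (QuotientGroup.mk' (c.1 0).normalCore) = c.1 i
  rw [Subgroup.comap_map_eq_self]
  rw [QuotientGroup.ker_mk']
  exact (Subgroup.normalCore_le _).trans (c.1.monotone (Fin.zero_le _))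

/-- Every simplex which does not vanish in `𝒞L̃_n` is the preimage of a simple chain. -/
lemma exists_comap_rep_eq (y : LClass n ⦋k⦌ G) (hy : y ∉ nullSimplices n k (op G)) :
    ∃ (x : SimpleChainClass n k) (ψ : G ⟶ x.rep.top),
      LClass.comap ψ (LClass.mk x.rep.toLChain) = y := by
  obtain ⟨c, rfl⟩ := LClass.mk_surjective y
  rw [LClass.mk_mem_nullSimplices_iff, not_not] at hy
  obtain ⟨f, hf⟩ := exists_comap_ofLChain c hy.1 hy.2
  obtain ⟨e, he⟩ := Quotient.mk_out (s := isoSetoid n k) (ofLChain c hy.1 hy.2)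
  refine ⟨Quotient.mk (isoSetoid n k) (ofLChain c hy.1 hy.2),
    OutCat.mkHom ⟨e.symm.toMonoidHom.comp f.1, e.symm.surjective.comp f.2⟩, ?_⟩
  rw [LClass.comap_mkHom_mk]
  refine congrArg LClass.mk (Eq.trans (Subtype.ext (OrderHom.ext _ _ (funext fun i => ?_))) hf)
  refine (Subgroup.comap_comap _ _ _).symm.trans (congrArg (Subgroup.comap f.1) ?_)
  refine Eq.trans ?_ (he i)
  exact Subgroup.comap_equiv_eq_map_symm' _ _

/-- The kernel of `f` lies in the common preimage, so its image under `g` is a normal subgroup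
inside `d.chain 0`, and simplicity of `d` kills it. -/
lemma ker_le_ker_of_comap_eq {c d : SimpleChain n k} (f : OutCat.Epim G c.top)
    (g : OutCat.Epim G d.top) (h : (c.chain 0).comap f.1 = (d.chain 0).comap g.1) :
    f.1.ker ≤ g.1.ker := by
  have h1 := d.simple (f.1.ker.map g.1) (Subgroup.Normal.map inferInstance _ g.2) (by
    rw [Subgroup.map_le_iff_le_comap, ← h]
    exact Subgroup.ker_le_comap _ _)
  rwa [Subgroup.map_eq_bot_iff] at h1

/-- Two surjections onto simple chains with the same preimage differ by an isomorphism of chains. -/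
lemma exists_equiv_of_comap_eq {c d : SimpleChain n k} (ψ : G ⟶ c.top) (φ : G ⟶ d.top)
    (h : LClass.comap ψ (LClass.mk c.toLChain) = LClass.comap φ (LClass.mk d.toLChain)) :
    ∃ e : c.top ≃* d.top, (∀ i, (c.chain i).map e.toMonoidHom = d.chain i) ∧
      ψ ≫ OutCat.mkHom (OutCat.ofEquiv e) = φ := by
  obtain ⟨f, rfl⟩ := OutCat.mkHom_surjective ψ
  obtain ⟨f', rfl⟩ := OutCat.mkHom_surjective φ
  rw [LClass.comap_mkHom_mk, LClass.comap_mkHom_mk, LClass.mk_eq_iff] at h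
  obtain ⟨a, ha⟩ := h
  -- The two preimage chains agree only up to conjugation by `a`. Conjugating `f'` by `f'.1 a` keeps
  -- its class in `Out` and makes them equal.
  let f'' : OutCat.Epim G d.top := ⟨(MulAut.conj (f'.1 a)).toMonoidHom.comp f'.1,
    (MulAut.conj (f'.1 a)).surjective.comp f'.2⟩
  have hf'' : OutCat.mkHom f'' = OutCat.mkHom f' := by
    refine ((OutCat.mkHom_eq_iff f' f'').2 ⟨f'.1 a, fun x => ?_⟩).symm
    simp [f'']
  have hcomap (i : Fin (k + 1)) : (c.chain i).comap f.1 = (d.chain i).comap f''.1 := by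
    ext x
    have hi : (d.chain i).comap f'.1 =
      ((c.chain i).comap f.1).map (MulAut.conj a).toMonoidHom := ha i
    have : a * x * a⁻¹ ∈ (d.chain i).comap f'.1 ↔ x ∈ (c.chain i).comap f.1 := by
      rw [hi, mem_map_conj_iff]
      simp [mul_assoc]
    rw [← this]
    simp [f'']
  have hker : f.1.ker = f''.1.ker :=
    le_antisymm (ker_le_ker_of_comap_eq f f'' (hcomap 0))
      (ker_le_ker_of_comap_eq f'' f (hcomap 0).symm)
  -- Both targets are the quotient of `G` by the same kernel.
  let e : c.top ≃* d.top := (QuotientGroup.quotientKerEquivOfSurjective f.1 f.2).symm.trans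
    ((QuotientGroup.quotientMulEquivOfEq hker).trans
      (QuotientGroup.quotientKerEquivOfSurjective f''.1 f''.2))
  have he (x : G) : e (f.1 x) = f''.1 x := by
    have : (QuotientGroup.quotientKerEquivOfSurjective f.1 f.2).symm (f.1 x) =
        QuotientGroup.mk x := by
      rw [MulEquiv.symm_apply_eq]
      rfl
    simp only [e, MulEquiv.trans_apply, this]
    rfl
  refine ⟨e, fun i => ?_, ?_⟩
  · ext y
    obtain ⟨x, rfl⟩ := f''.2 y
    have hx : f.1 x ∈ c.chain i ↔ f''.1 x ∈ d.chain i := SetLike.ext_iff.1 (hcomap i) x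
    rw [← hx, ← he]
    exact Subgroup.mem_map_equiv.trans (by simp)
  · rw [← hf'', OutCat.mkHom_comp]
    exact congrArg OutCat.mkHom (Subtype.ext (MonoidHom.ext he))

/-- An isomorphism of finite groups as an isomorphism in `Out`. -/
def _root_.OutCat.isoOfEquiv {G K : OutCat} (e : G ≃* K) : G ≅ K where
  hom := OutCat.mkHom (OutCat.ofEquiv e)
  inv := OutCat.mkHom (OutCat.ofEquiv e.symm)
  hom_inv_id := by
    rw [OutCat.mkHom_comp, ← OutCat.mkHom_id]
    congr 1
    ext x
    simp [OutCat.ofEquiv]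
  inv_hom_id := by
    rw [OutCat.mkHom_comp, ← OutCat.mkHom_id]
    congr 1
    ext x
    simp [OutCat.ofEquiv]

/-- The class of a surjection in the orbit module. -/
def orbitMk (c : SimpleChain n k) {G : OutCatᵒᵖ} (ψ : G.unop ⟶ c.top) : c.orbitModule.obj G :=
  c.orbitSub.proj.app G (ModuleCat.freeMk ψ)

lemma orbitMk_map (c : SimpleChain n k) {G K : OutCatᵒᵖ} (f : G ⟶ K) (ψ : G.unop ⟶ c.top) :
    c.orbitModule.map f (c.orbitMk ψ) = c.orbitMk (f.unop ≫ ψ) :=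
  (ConcreteCategory.congr_hom (c.orbitSub.proj.naturality f) (ModuleCat.freeMk ψ)).symm.trans
    (congrArg (c.orbitSub.proj.app K) (ModuleCat.free_map_apply _ _))

lemma orbitMk_comp (c : SimpleChain n k) {G : OutCatᵒᵖ} (ψ : G.unop ⟶ c.top) {α : Aut c.top}
    (hα : α ∈ c.outGroup) : c.orbitMk (ψ ≫ α.hom) = c.orbitMk ψ :=
  (c.orbitSub.proj_app_eq_iff G _ _).2 (Submodule.subset_span ⟨α, hα, ψ, rfl⟩)

/-- The class of a simplex in `(𝒞L̃_n)_k`. -/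
def _root_.CL.mk {G : OutCatᵒᵖ} (y : LClass n ⦋k⦌ G.unop) : ((CL n).X k).obj G :=
  (nullSub n k).proj.app G (ModuleCat.freeMk y)

lemma _root_.CL.mk_eq_zero {G : OutCatᵒᵖ} {y : LClass n ⦋k⦌ G.unop}
    (hy : y ∈ nullSimplices n k G) : CL.mk y = 0 :=
  ((nullSub n k).proj_app_eq_zero_iff G _).2 (Submodule.subset_span ⟨y, hy, rfl⟩)

lemma orbitMap_orbitMk (c : SimpleChain n k) {G : OutCatᵒᵖ} (ψ : G.unop ⟶ c.top) :
    c.orbitMap.app G (c.orbitMk ψ) = CL.mk (LClass.comap ψ (LClass.mk c.toLChain)) :=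
  congrArg ((nullSub n k).proj.app G) (c.preimageMap_freeMk G ψ)

lemma orbitModule_hom_ext {c : SimpleChain n k} {Q : OutMod} {f g : c.orbitModule ⟶ Q}
    (h : ∀ (G : OutCatᵒᵖ) (ψ : G.unop ⟶ c.top),
      f.app G (c.orbitMk ψ) = g.app G (c.orbitMk ψ)) : f = g :=
  OutMod.Sub.hom_ext c.orbitSub (OutMod.free_hom_ext (F := yoneda.obj c.top) h)

end SimpleChain

lemma CL.hom_ext {n : ℕ∞} {k : ℕ} {Q : OutMod} {f g : (CL n).X k ⟶ Q}
    (h : ∀ (G : OutCatᵒᵖ) (y : LClass n ⦋k⦌ G.unop), f.app G (CL.mk y) = g.app G (CL.mk y)) :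
    f = g :=
  OutMod.Sub.hom_ext (nullSub n k)
    (OutMod.free_hom_ext (F := (latticeQuot n).flip.obj (op ⦋k⦌)) h)

/-! ### The universal property of the direct sum -/

namespace SimpleChainClass

variable {n : ℕ∞} {k : ℕ} {Q : OutMod} (t : ∀ x : SimpleChainClass n k, x.rep.orbitModule ⟶ Q)

/-- This makes the value assigned to a simplex independent of the representation chosen in
`descFun`. -/
lemma app_orbitMk_eq {G : OutCatᵒᵖ} {x x' : SimpleChainClass n k} (ψ : G.unop ⟶ x.rep.top)
    (ψ' : G.unop ⟶ x'.rep.top)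
    (h : LClass.comap ψ (LClass.mk x.rep.toLChain) = LClass.comap ψ' (LClass.mk x'.rep.toLChain)) :
    (t x).app G (x.rep.orbitMk ψ) = (t x').app G (x'.rep.orbitMk ψ') := by
  obtain ⟨e, he, hψ⟩ := SimpleChain.exists_equiv_of_comap_eq ψ ψ' h
  -- Isomorphic chosen representatives belong to the same class, after which `e` is an automorphism
  -- preserving the chain, so it acts trivially on the orbit module.
  obtain rfl : x = x' := by
    have : SimpleChain.isoSetoid n k x.rep x'.rep := ⟨e, he⟩
    exact Quotient.out_equiv_out.1 this
  have : OutCat.isoOfEquiv e ∈ x.rep.outGroup :=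
    ⟨e, rfl, 1, fun i => (he i).trans (by ext; simp)⟩
  rw [← hψ]
  exact congrArg ((t x).app G) (x.rep.orbitMk_comp ψ this).symm

open Classical in
/-- The value on a simplex of the map out of `(𝒞L̃_n)_k` given by maps out of the orbit modules. -/
def descFun (G : OutCatᵒᵖ) (y : LClass n ⦋k⦌ G.unop) : Q.obj G :=
  if hy : y ∈ nullSimplices n k G then 0 else
    (t (SimpleChain.exists_comap_rep_eq y hy).choose).app G
      (SimpleChain.orbitMk _ (SimpleChain.exists_comap_rep_eq y hy).choose_spec.choose)

lemma descFun_of_mem (G : OutCatᵒᵖ) (y : LClass n ⦋k⦌ G.unop) (hy : y ∈ nullSimplices n k G) :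
    descFun t G y = 0 := dif_pos hy

lemma descFun_comap {G : OutCatᵒᵖ} {x : SimpleChainClass n k} (ψ : G.unop ⟶ x.rep.top) :
    descFun t G (LClass.comap ψ (LClass.mk x.rep.toLChain)) = (t x).app G (x.rep.orbitMk ψ) := by
  have hy : LClass.comap ψ (LClass.mk x.rep.toLChain) ∉ nullSimplices n k G := fun h =>
    x.rep.mk_toLChain_notMem_nullSimplices ((LClass.comap_mem_nullSimplices_iff _ _).1 h)
  rw [descFun, dif_neg hy]
  exact app_orbitMk_eq t _ _ (SimpleChain.exists_comap_rep_eq _ hy).choose_spec.choose_spec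

lemma descFun_map (G K : OutCatᵒᵖ) (f : G ⟶ K) (y : LClass n ⦋k⦌ G.unop) :
    descFun t K (LClass.comap f.unop y) = Q.map f (descFun t G y) := by
  by_cases hy : y ∈ nullSimplices n k G
  · rw [descFun_of_mem t K _ ((LClass.comap_mem_nullSimplices_iff _ _).2 hy),
      descFun_of_mem t G _ hy, map_zero]
  · obtain ⟨x, ψ, rfl⟩ := SimpleChain.exists_comap_rep_eq y hy
    rw [← LClass.comap_comp, descFun_comap, descFun_comap, ← SimpleChain.orbitMk_map]
    exact ConcreteCategory.congr_hom ((t x).naturality f) _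

/-- The map out of `(𝒞L̃_n)_k` given by maps out of the orbit modules. -/
def desc : (CL n).X k ⟶ Q :=
  (nullSub n k).desc
    (OutMod.freeHom (F := (latticeQuot n).flip.obj (op ⦋k⦌)) (descFun t) (descFun_map t)) (by
      intro G
      change Submodule.span ℚ _ ≤ _
      rw [Submodule.span_le]
      rintro _ ⟨y, hy, rfl⟩
      exact (OutMod.freeHom_freeMk _ (descFun_map t) _ _).trans (descFun_of_mem t G y hy))

lemma desc_mk {G : OutCatᵒᵖ} (y : LClass n ⦋k⦌ G.unop) :
    (desc t).app G (CL.mk y) = descFun t G y :=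
  OutMod.freeHom_freeMk (F := (latticeQuot n).flip.obj (op ⦋k⦌)) _ (descFun_map t) G y

end SimpleChainClass

/-- `(𝒞L̃_n)_k` is the direct sum of the orbit modules. -/
def isColimitOrbitCofan (n : ℕ∞) (k : ℕ) : IsColimit (orbitCofan n k) :=
  Cofan.IsColimit.mk _ (fun s => SimpleChainClass.desc s.inj)
    (fun s x => SimpleChain.orbitModule_hom_ext fun G ψ => by
      refine (congrArg ((SimpleChainClass.desc s.inj).app G) (x.rep.orbitMap_orbitMk ψ)).trans ?_
      rw [SimpleChainClass.desc_mk, SimpleChainClass.descFun_comap])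
    (fun s m hm => CL.hom_ext fun G y => by
      rw [SimpleChainClass.desc_mk]
      by_cases hy : y ∈ nullSimplices n k G
      · rw [SimpleChainClass.descFun_of_mem _ G y hy, CL.mk_eq_zero hy, map_zero]
      · obtain ⟨x, ψ, rfl⟩ := SimpleChain.exists_comap_rep_eq y hy
        rw [SimpleChainClass.descFun_comap, ← hm x, ← SimpleChain.orbitMap_orbitMk]
        rfl)

lemma projective_CL_X (n : ℕ∞) (k : ℕ) : Projective ((CL n).X k) :=
  projective_of_isColimit_cofan _ (isColimitOrbitCofan n k)
    fun x => x.rep.projective_orbitModule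

/-! ### The contraction -/

namespace LChain

variable {k : ℕ} {G : OutCat}

/-- The chain obtained by adding the trivial subgroup at the bottom. -/
def cone (c : LChain ⊤ ⦋k⦌ G) : LChain ⊤ ⦋k + 1⦌ G :=
  ⟨⟨Fin.cons (α := fun _ : Fin (k + 2) => Subgroup G) ⊥ c.1, by
    intro i j h
    induction i using Fin.cases with
    | zero => exact bot_le
    | succ i =>
      induction j using Fin.cases with
      | zero => simp at h
      | succ j => exact c.1.monotone (Fin.succ_le_succ_iff.1 h)⟩, le_top⟩

/-- The one-term chain given by a subgroup. -/
def single (H : Subgroup G) : LChain ⊤ ⦋0⦌ G := ⟨⟨fun _ => H, fun _ _ _ => le_rfl⟩, le_top⟩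

lemma pull_δ_succ_cone (c : LChain ⊤ ⦋k + 1⦌ G) (i : Fin (k + 2)) :
    pull (SimplexCategory.δ i.succ) c.cone = (pull (SimplexCategory.δ i) c).cone := by
  refine Subtype.ext (OrderHom.ext _ _ (funext fun j => ?_))
  change c.cone.1 (i.succ.succAbove j) = _
  induction j using Fin.cases with
  | zero => rw [Fin.succ_succAbove_zero]; rfl
  | succ j => rw [Fin.succ_succAbove_succ]; rfl

lemma pull_δ_one_cone (c : LChain ⊤ ⦋0⦌ G) : pull (SimplexCategory.δ 1) c.cone = single ⊥ := by
  refine Subtype.ext (OrderHom.ext _ _ (funext fun j => ?_))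
  obtain rfl : j = (0 : Fin 1) := Subsingleton.elim (α := Fin 1) _ _
  rfl

end LChain

namespace LClass

variable {k : ℕ} {G : OutCat}

/-- Adding the trivial subgroup at the bottom, on conjugacy classes of chains. -/
def cone : LClass ⊤ ⦋k⦌ G → LClass ⊤ ⦋k + 1⦌ G :=
  Quotient.map (sa := LChain.conjSetoid ⊤ ⦋k⦌ G) (sb := LChain.conjSetoid ⊤ ⦋k + 1⦌ G)
    LChain.cone (by
      rintro c d ⟨g, h⟩
      refine ⟨g, fun i => ?_⟩
      induction i using Fin.cases with
      | zero => exact (Subgroup.map_bot _).symm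
      | succ i => exact h i)

lemma cone_mk (c : LChain ⊤ ⦋k⦌ G) : cone (mk c) = mk c.cone := rfl

/-- If the cone is strict and ends in `G`, so does the original chain. This is why coning descends
to the quotient by null chains. -/
lemma cone_mem_nullSimplices {y : LClass ⊤ ⦋k⦌ G} (hy : y ∈ nullSimplices ⊤ k (op G)) :
    cone y ∈ nullSimplices ⊤ (k + 1) (op G) := by
  obtain ⟨c, rfl⟩ := mk_surjective y
  rw [cone_mk]
  rw [mk_mem_nullSimplices_iff] at hy ⊢
  rintro ⟨h, hl⟩
  exact hy ⟨fun i j hij => h (Fin.succ_lt_succ_iff.2 hij), hl⟩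

lemma pull_δ_zero_cone (y : LClass ⊤ ⦋k⦌ G) : pull (SimplexCategory.δ 0) (cone y) = y := by
  obtain ⟨c, rfl⟩ := mk_surjective y
  rfl

lemma pull_δ_succ_cone (y : LClass ⊤ ⦋k + 1⦌ G) (i : Fin (k + 2)) :
    pull (SimplexCategory.δ i.succ) (cone y) = cone (pull (SimplexCategory.δ i) y) := by
  obtain ⟨c, rfl⟩ := mk_surjective y
  exact congrArg mk (c.pull_δ_succ_cone i)

lemma pull_δ_one_cone (y : LClass ⊤ ⦋0⦌ G) :
    pull (SimplexCategory.δ 1) (cone y) = mk (LChain.single ⊥) := by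
  obtain ⟨c, rfl⟩ := mk_surjective y
  exact congrArg mk c.pull_δ_one_cone

lemma mk_mem_nullSimplices_zero_iff {n : ℕ∞} (c : LChain n ⦋0⦌ G) :
    mk c ∈ nullSimplices n 0 (op G) ↔ c.1 (Fin.last 0) ≠ ⊤ := by
  rw [mk_mem_nullSimplices_iff, and_iff_right (Subsingleton.strictMono (α := Fin 1) _)]

end LClass

/-! ### Contracting homotopy, augmentation and exactness -/

namespace CL

variable {k : ℕ} {G : OutCatᵒᵖ}

lemma d_mk {n : ℕ∞} (y : LClass n ⦋k + 1⦌ G.unop) :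
    ((CL n).d (k + 1) k).app G (CL.mk y) = ∑ i : Fin (k + 2), (-1 : ℤ) ^ (i : ℕ) •
      (CL.mk (LClass.pull (SimplexCategory.δ i) y) : ((CL n).X k).obj G) := by
  have h : (CL n).d (k + 1) k = (nullSub n (k + 1)).map (nullSub n k)
      (AlgebraicTopology.AlternatingFaceMapComplex.objD (latticeModule n) k) (null_face n k) :=
    ChainComplex.of_d (fun k => (nullSub n k).quotient) (fun k => (nullSub n (k + 1)).map
      (nullSub n k) (AlgebraicTopology.AlternatingFaceMapComplex.objD (latticeModule n) k)
      (null_face n k)) k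
  rw [h]
  refine (congrArg ((nullSub n k).proj.app G) (objD_freeMk n k G y)).trans ?_
  refine (map_sum ((nullSub n k).proj.app G).hom _ _).trans (Finset.sum_congr rfl fun i _ => ?_)
  exact map_zsmul ((nullSub n k).proj.app G).hom _ _

/-- Linear maps out of a module of chains agree if they agree on simplices. -/
lemma linearMap_ext {n : ℕ∞} {M : Type*} [AddCommGroup M] [Module ℚ M]
    {f g : ((CL n).X k).obj G →ₗ[ℚ] M}
    (h : ∀ y : LClass n ⦋k⦌ G.unop, f (CL.mk y) = g (CL.mk y)) : f = g :=
  Submodule.linearMap_qext _ (Finsupp.lhom_ext' fun y => LinearMap.ext_ring (h y))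

/-- The contracting homotopy on `𝒞L̃(G)`. -/
def contraction (k : ℕ) (G : OutCatᵒᵖ) :
    ((CL ⊤).X k).obj G →ₗ[ℚ] ((CL ⊤).X (k + 1)).obj G :=
  Submodule.liftQ ((nullSub ⊤ k).carrier G)
    (ModuleCat.freeDesc (↾fun y : LClass ⊤ ⦋k⦌ G.unop =>
      (CL.mk (LClass.cone y) : ((CL ⊤).X (k + 1)).obj G))).hom (by
    change Submodule.span ℚ _ ≤ _
    rw [Submodule.span_le]
    rintro _ ⟨y, hy, rfl⟩
    exact (ModuleCat.freeDesc_apply _ y).trans (CL.mk_eq_zero (LClass.cone_mem_nullSimplices hy)))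

lemma contraction_mk (y : LClass ⊤ ⦋k⦌ G.unop) :
    contraction k G (CL.mk y) = CL.mk (LClass.cone y) :=
  ModuleCat.freeDesc_apply _ y

lemma d_contraction_add (x : ((CL ⊤).X (k + 1)).obj G) :
    ((CL ⊤).d (k + 2) (k + 1)).app G (contraction (k + 1) G x) +
      contraction k G (((CL ⊤).d (k + 1) k).app G x) = x := by
  have : (((CL ⊤).d (k + 2) (k + 1)).app G).hom ∘ₗ contraction (k + 1) G +
      contraction k G ∘ₗ (((CL ⊤).d (k + 1) k).app G).hom = LinearMap.id := by
    refine linearMap_ext fun y => ?_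
    change ((CL ⊤).d (k + 2) (k + 1)).app G (contraction (k + 1) G (CL.mk y)) +
      contraction k G (((CL ⊤).d (k + 1) k).app G (CL.mk y)) = CL.mk y
    rw [contraction_mk, d_mk, d_mk, map_sum, Fin.sum_univ_succ, LClass.pull_δ_zero_cone]
    -- Face `0` of the cone returns `y`; face `i + 1` is the cone of face `i` with the opposite
    -- sign, so these terms cancel against the second summand.
    simp only [map_zsmul, contraction_mk, LClass.pull_δ_succ_cone, Fin.val_zero, pow_zero,
      one_smul, Fin.val_succ, pow_succ, mul_neg, mul_one, neg_smul, Finset.sum_neg_distrib]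
    exact neg_add_cancel_right _ _
  exact LinearMap.congr_fun this x

/-- The augmentation of the module of `0`-simplices. -/
def augmentationFree :
    (latticeModule ⊤).obj (op ⦋0⦌) ⟶ (Functor.const OutCatᵒᵖ).obj (ModuleCat.of ℚ ℚ) :=
  OutMod.freeHom (F := (latticeQuot ⊤).flip.obj (op ⦋0⦌)) (fun _ _ => (1 : ℚ)) fun _ _ _ _ => rfl

lemma augmentationFree_freeMk (y : LClass ⊤ ⦋0⦌ G.unop) :
    augmentationFree.app G (ModuleCat.freeMk y) = (1 : ℚ) :=
  OutMod.freeHom_freeMk (F := (latticeQuot ⊤).flip.obj (op ⦋0⦌)) _ (fun _ _ _ _ => rfl) G y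

/-- The augmentation of `𝒞L̃`. -/
def augmentation : (CL ⊤).X 0 ⟶ OutMod.atTrivial :=
  (nullSub ⊤ 0).map OutMod.atTrivialSub augmentationFree (fun G => by
    change Submodule.span ℚ _ ≤ _
    rw [Submodule.span_le]
    rintro _ ⟨y, hy, rfl⟩
    obtain ⟨c, rfl⟩ := LClass.mk_surjective y
    have hne := (LClass.mk_mem_nullSimplices_zero_iff c).1 hy
    -- A null vertex is a proper subgroup, so it occurs only where the target module vanishes.
    have hG : Nontrivial G.unop := by
      by_contra h
      rw [not_nontrivial_iff_subsingleton] at h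
      exact hne (Subsingleton.elim _ _)
    exact Submodule.mem_iSup_of_mem hG Submodule.mem_top)

lemma augmentation_mk (y : LClass ⊤ ⦋0⦌ G.unop) :
    augmentation.app G (CL.mk y) = OutMod.atTrivialSub.proj.app G (1 : ℚ) :=
  congrArg (OutMod.atTrivialSub.proj.app G) (augmentationFree_freeMk y)

lemma augmentation_app_surjective (G : OutCatᵒᵖ) : Function.Surjective (augmentation.app G) := by
  intro z
  obtain ⟨q, rfl⟩ := OutMod.atTrivialSub.proj_app_surjective G z
  let r : ℚ := q
  refine ⟨r • CL.mk (LClass.mk (LChain.single ⊤)), ?_⟩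
  refine (map_smul (augmentation.app G).hom _ _).trans ?_
  refine (congrArg (r • ·) (augmentation_mk _)).trans ?_
  refine (map_smul (OutMod.atTrivialSub.proj.app G).hom r (1 : ℚ)).symm.trans ?_
  exact congrArg (OutMod.atTrivialSub.proj.app G) (mul_one r)

lemma d_comp_augmentation : (CL ⊤).d 1 0 ≫ augmentation = 0 := by
  refine CL.hom_ext fun G y => ?_
  change augmentation.app G (((CL ⊤).d 1 0).app G (CL.mk y)) = 0
  rw [d_mk, Fin.sum_univ_two, map_add, map_zsmul, map_zsmul, augmentation_mk, augmentation_mk]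
  refine (add_smul ((-1 : ℤ) ^ 0) ((-1 : ℤ) ^ 1)
    (OutMod.atTrivialSub.proj.app G (1 : ℚ))).symm.trans ?_
  exact zero_smul ℤ _

/-- The cone over a vertex `y` is an edge with boundary `y - [⊥]`. The identity is stated for free
chains because the `ℚ`-valued augmentation does not vanish on null simplices, so it does not descend
to the quotient for nontrivial `G`. -/
lemma d_contraction_zero (v : ((latticeModule ⊤).obj (op ⦋0⦌)).obj G) :
    ((CL ⊤).d 1 0).app G (contraction 0 G ((nullSub ⊤ 0).proj.app G v)) +
      (augmentationFree.app G v : ℚ) • CL.mk (LClass.mk (LChain.single ⊥)) =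
      (nullSub ⊤ 0).proj.app G v := by
  have : (((CL ⊤).d 1 0).app G).hom ∘ₗ contraction 0 G ∘ₗ ((nullSub ⊤ 0).proj.app G).hom +
      LinearMap.toSpanSingleton ℚ (((CL ⊤).X 0).obj G) (CL.mk (LClass.mk (LChain.single ⊥))) ∘ₗ
        (augmentationFree.app G).hom = ((nullSub ⊤ 0).proj.app G).hom := by
    refine Finsupp.lhom_ext' fun (y : LClass ⊤ ⦋0⦌ G.unop) => LinearMap.ext_ring ?_
    change ((CL ⊤).d 1 0).app G (contraction 0 G (CL.mk y)) +
      (augmentationFree.app G (ModuleCat.freeMk y) : ℚ) •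
        CL.mk (LClass.mk (LChain.single ⊥)) = CL.mk y
    rw [contraction_mk, d_mk, Fin.sum_univ_two, augmentationFree_freeMk, LClass.pull_δ_zero_cone,
      LClass.pull_δ_one_cone]
    simp
  exact LinearMap.congr_fun this v

lemma exists_d_eq_of_augmentation_eq_zero (x : ((CL ⊤).X 0).obj G)
    (hx : augmentation.app G x = 0) : ∃ z, ((CL ⊤).d 1 0).app G z = x := by
  obtain ⟨v, rfl⟩ := (nullSub ⊤ 0).proj_app_surjective G x
  refine ⟨contraction 0 G ((nullSub ⊤ 0).proj.app G v), Eq.trans ?_ (d_contraction_zero v)⟩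
  refine (add_eq_left.2 ?_).symm
  -- The error term is a multiple of `[⊥]`. For nontrivial `G` this vertex is null; for trivial `G`
  -- the coefficient is zero, since nothing is divided out of `ℚ` there.
  by_cases hG : Nontrivial G.unop
  · have h : LClass.mk (LChain.single ⊥) ∈ nullSimplices ⊤ 0 G :=
      (LClass.mk_mem_nullSimplices_zero_iff _).2 bot_ne_top
    rw [CL.mk_eq_zero h, smul_zero]
  · have h : augmentationFree.app G v ∈ OutMod.atTrivialSub.carrier G :=
      (OutMod.atTrivialSub.proj_app_eq_zero_iff G _).1 hx
    have h0 : OutMod.atTrivialSub.carrier G = ⊥ := iSup_neg hG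
    rw [h0, Submodule.mem_bot] at h
    exact (congrArg (fun q : ℚ => q • _) h).trans (zero_smul _ _)

end CL

/-- `𝒞L̃` as a projective resolution. -/
def CL.resolution : ProjectiveResolution OutMod.atTrivial where
  complex := CL ⊤
  projective k := projective_CL_X ⊤ k
  π := (ChainComplex.toSingle₀Equiv _ _).symm ⟨CL.augmentation, CL.d_comp_augmentation⟩
  quasiIso := ⟨fun k => by
    cases k with
    | zero =>
      -- In degree `0` the claim amounts to exactness at `(CL ⊤).X 0` of the augmented complex,
      -- together with surjectivity of the augmentation.
      rw [ChainComplex.quasiIsoAt₀_iff, ShortComplex.quasiIso_iff_of_zeros']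
      · refine (ShortComplex.exact_and_epi_g_iff_of_iso (S₂ := ShortComplex.mk _ _
          CL.d_comp_augmentation) ?_).2 ⟨OutMod.exact_of_app _ fun G x hx =>
            CL.exists_d_eq_of_augmentation_eq_zero x hx, ?_⟩
        · exact ShortComplex.isoMk (Iso.refl _) (Iso.refl _) (Iso.refl _)
            ((Category.id_comp _).trans (Category.comp_id _).symm)
            ((Category.id_comp _).trans (Category.comp_id _).symm)
        · have (G : OutCatᵒᵖ) : Epi (CL.augmentation.app G) :=
            (ModuleCat.epi_iff_surjective _).2 (CL.augmentation_app_surjective G)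
          exact NatTrans.epi_of_epi_app CL.augmentation
      all_goals rfl
    | succ k =>
      rw [quasiIsoAt_iff_exactAt']
      · rw [HomologicalComplex.exactAt_iff' _ (k + 2) (k + 1) k (by simp) (by simp)]
        refine OutMod.exact_of_app _ fun G x hx => ⟨CL.contraction (k + 1) G x, ?_⟩
        refine Eq.trans ?_ (CL.d_contraction_add x)
        have hx' : ((CL ⊤).d (k + 1) k).app G x = 0 := hx
        rw [hx', map_zero, add_zero]
        rfl
      · apply ChainComplex.exactAt_succ_single_obj⟩

end

theorem mainTheorem8 :
    (∀ (n : ℕ∞) (k : ℕ), Projective ((CL n).X k)) ∧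
    (∀ (n : ℕ∞) (k : ℕ), Nonempty (IsColimit (orbitCofan n k))) ∧
    (∃ P : ProjectiveResolution OutMod.atTrivial, P.complex = CL ⊤) :=
  ⟨projective_CL_X, fun n k => ⟨isColimitOrbitCofan n k⟩, CL.resolution, rfl⟩
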